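/- Consider the Fornasini--Marchesini II system with two scalar faults $f_1,f_2$, $$x(i+1,j+1)=A_1x(i,j+1)+A_2x(i+1,j)+B_1u(i,j+1)+B_2u(i+1,j)+\sum_{k=1}^2\bigl(L_k^1f_k(i,j+1)+L_k^2f_k(i+1,j)\bigr),\qquad y(i,j)=Cx(i,j),$$ with $x\in\mathbb R^n$, $u\in\mathbb R^m$, $y\in\mathbb R^q$ real, on the half plane $i+j\ge 0$ with arbitrary initial values on $i+j=0$. For matrices $D_1,D_2,H$ let $\langle\ker HC\mid[A+DC]_{1,2}\rangle$ be the largest subspace of $\ker HC$ that is invariant under both $A_1+D_1C$ and $A_2+D_2C$; the subspaces of $\mathbb R^n$ of this form are the (finite) unobservability subspaces. For $k\in\{1,2\}$ let $k'$ be the other index, let $\mathscr L_k=\operatorname{span}(L_k^1)+\operatorname{span}(L_k^2)$, and let $\mathscr S_k^*$ be the smallest unobservability subspace containing $\mathscr L_{k'}$. A quotient subsystem for the fault $f_k$ consists of a surjective matrix $P:\mathbb R^n\to\mathbb R^d$ with $\ker P=\mathscr S_k^*$ (the canonical projection onto $\mathbb R^n/\mathscr S_k^*$ in coordinates), and matrices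 $D_1,D_2,H,A_1^p,A_2^p,M$ with $A_i^pP=P(A_i+D_iC)$ for $i=1,2$, $\ker HC=\mathscr S_k^*+\ker C$ and $MP=HC$. Suppose that $$\mathscr L_k\not\subseteq\mathscr S_k^*\qquad\text{and}\qquad \operatorname{rank}\begin{bmatrix}I-z_1A_1^p-z_2A_2^p\\ M\end{bmatrix}=d\quad\text{for all }z_1,z_2\in\mathbb C .$$ Then the fault detection and isolation problem for $f_k$ is solved by an ordinary (non-delayed) deadbeat observer of this quotient subsystem, that is: (i) $f_k$ is detectable and isolable: with $\mathscr S=\langle\ker HC\mid[A+DC]_{1,2}\rangle$ one has $\mathscr S=\ker P$, $\mathscr L_{k'}\subseteq\mathscr S$ and $\mathscr L_k\not\subseteq\mathscr S$. (ii) There are a filter $$z(i+1,j+1)=F_1z(i,j+1)+F_2z(i+1,j)+K_1u(i,j+1)+K_2u(i+1,j)+E_1y(i,j+1)+E_2y(i+1,j),\qquad \hat\omega(i,j)=G_1z(i,j)+G_2y(i,j),$$ with residual $r_k(i,j)=M\hat\omega(i,j)-Hy(i,j)$, and an integer $N_0\ge 0$, such that for all $u$, all $f_{k'}$ and all initial values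 of $x$ and $z$ on $i+j=0$: if $f_k=0$ on $i+j\ge0$, then $\hat\omega(i,j)=Px(i,j)$ and $r_k(i,j)=0$ whenever $i+j>N_0$. (iii) Call $f_k$ visible if the zero-initial-value response $w$ of the quotient subsystem, $w(i+1,j+1)=A_1^pw(i,j+1)+A_2^pw(i+1,j)+PL_k^1f_k(i,j+1)+PL_k^2f_k(i+1,j)$, has $Mw\not\equiv0$ on $i+j\ge 0$. With the same filter and $N_0$, for every visible $f_k$ and all $u,f_{k'}$: if the initial values of $x$ and $z$ are zero, then $r_k(i,j)\ne0$ for some $i+j\ge0$; and if $f_k(i,j)=0$ for $0\le i+j\le N_0$, then for all initial values $r_k(i,j)\neq0$ for some $i+j>N_0$. In particular, if for each $k\in\{1,2\}$ there is a quotient subsystem satisfying these hypotheses, then the fault detection and isolation problem for the system (for each of the two faults, a subsystem with properties (i) and an observer with properties (ii), (iii)) is solvable by ordinary deadbeat observers. -/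

import Mathlib

open scoped Matrix

/-- A Fornasini--Marchesini II system with `n` states, `m` inputs, `q` outputs and two scalar
faults; `L1 k`, `L2 k` are the two signatures of the `k`-th fault. -/
structure FMII (n m q : ℕ) where
  A1 : Matrix (Fin n) (Fin n) ℝ
  A2 : Matrix (Fin n) (Fin n) ℝ
  B1 : Matrix (Fin n) (Fin m) ℝ
  B2 : Matrix (Fin n) (Fin m) ℝ
  C : Matrix (Fin q) (Fin n) ℝ
  L1 : Fin 2 → Fin n → ℝ
  L2 : Fin 2 → Fin n → ℝ

/-- `⟨K | A_{1,2}⟩`: the largest subspace of `K` that is invariant under both `A1` and `A2`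
(the supremum of all such subspaces, which is again one of them). -/
def largestInvariant {n : ℕ} (K : Submodule ℝ (Fin n → ℝ)) (A1 A2 : Matrix (Fin n) (Fin n) ℝ) :
    Submodule ℝ (Fin n → ℝ) :=
  sSup {V | V ≤ K ∧ V.map A1.mulVecLin ≤ V ∧ V.map A2.mulVecLin ≤ V}

namespace FMII

variable {n m q : ℕ}

/-- `x` is a state trajectory for the input `u` and the faults `f`.  Time runs over the half plane
`i + j ≥ 0`; the values of `x` on the separation set `i + j = 0` are free initial values. -/
def IsTrajectory (sys : FMII n m q) (u : ℤ → ℤ → Fin m → ℝ) (f : Fin 2 → ℤ → ℤ → ℝ)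
    (x : ℤ → ℤ → Fin n → ℝ) : Prop :=
  ∀ i j : ℤ, 0 ≤ i + j + 1 →
    x (i + 1) (j + 1) = sys.A1 *ᵥ x i (j + 1) + sys.A2 *ᵥ x (i + 1) j
      + sys.B1 *ᵥ u i (j + 1) + sys.B2 *ᵥ u (i + 1) j
      + ∑ k, f k i (j + 1) • sys.L1 k + ∑ k, f k (i + 1) j • sys.L2 k

/-- The span of the two signatures of the `k`-th fault. -/
def faultSpace (sys : FMII n m q) (k : Fin 2) : Submodule ℝ (Fin n → ℝ) :=
  Submodule.span ℝ {sys.L1 k} ⊔ Submodule.span ℝ {sys.L2 k}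

/-- The invariant unobservable subspace `⟨ker HC | [A + DC]_{1,2}⟩` of the triple
`(HC, A1 + D1 C, A2 + D2 C)`. -/
def unobservable (sys : FMII n m q) {s : ℕ} (D1 D2 : Matrix (Fin n) (Fin q) ℝ)
    (H : Matrix (Fin s) (Fin q) ℝ) : Submodule ℝ (Fin n → ℝ) :=
  largestInvariant (LinearMap.ker (H * sys.C).mulVecLin)
    (sys.A1 + D1 * sys.C) (sys.A2 + D2 * sys.C)

/-- `S` is a (finite) unobservability subspace. -/
def IsUnobservability (sys : FMII n m q) (S : Submodule ℝ (Fin n → ℝ)) : Prop :=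
  ∃ (s : ℕ) (D1 D2 : Matrix (Fin n) (Fin q) ℝ) (H : Matrix (Fin s) (Fin q) ℝ),
    S = sys.unobservable D1 D2 H

/-- `S` is the smallest unobservability subspace containing the signatures of the fault other
than the `k`-th one (`Fin.rev` exchanges the two indices). -/
def IsSmallestUnobservability (sys : FMII n m q) (k : Fin 2)
    (S : Submodule ℝ (Fin n → ℝ)) : Prop :=
  IsLeast {T | sys.IsUnobservability T ∧ sys.faultSpace k.rev ≤ T} S

/-- The data of a subsystem on `ℝⁿ / S`.  The quotient is given coordinates `ℝᵈ`, so the canonical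
projection is a surjective matrix `P` with kernel `S`; the subsystem has state matrices `Ap1`,
`Ap2` with `Apᵢ P = P (Aᵢ + Dᵢ C)` and output matrix `M` with `M P = H C`. -/
structure Subsystem (sys : FMII n m q) (S : Submodule ℝ (Fin n → ℝ)) where
  d : ℕ
  s : ℕ
  D1 : Matrix (Fin n) (Fin q) ℝ
  D2 : Matrix (Fin n) (Fin q) ℝ
  H : Matrix (Fin s) (Fin q) ℝ
  P : Matrix (Fin d) (Fin n) ℝ
  Ap1 : Matrix (Fin d) (Fin d) ℝ
  Ap2 : Matrix (Fin d) (Fin d) ℝ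
  M : Matrix (Fin s) (Fin d) ℝ
  surjective : Function.Surjective P.mulVecLin
  ker_P : LinearMap.ker P.mulVecLin = S
  Ap1_mul : Ap1 * P = P * (sys.A1 + D1 * sys.C)
  Ap2_mul : Ap2 * P = P * (sys.A2 + D2 * sys.C)
  M_mul : M * P = H * sys.C

/-- A filter driven by `u` and `y`, with state in `ℝᵒ`, whose output in `ℝᵈ` is
`G1 z + G2 y`. -/
structure Observer (m q d : ℕ) where
  o : ℕ
  F1 : Matrix (Fin o) (Fin o) ℝ
  F2 : Matrix (Fin o) (Fin o) ℝ
  K1 : Matrix (Fin o) (Fin m) ℝ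
  K2 : Matrix (Fin o) (Fin m) ℝ
  E1 : Matrix (Fin o) (Fin q) ℝ
  E2 : Matrix (Fin o) (Fin q) ℝ
  G1 : Matrix (Fin d) (Fin o) ℝ
  G2 : Matrix (Fin d) (Fin q) ℝ

namespace Observer

variable {d : ℕ}

/-- `z` is a state trajectory of the filter for the signals `u` and `y`, with free initial values
on `i + j = 0`. -/
def IsTrajectory (O : Observer m q d) (u : ℤ → ℤ → Fin m → ℝ) (y : ℤ → ℤ → Fin q → ℝ)
    (z : ℤ → ℤ → Fin O.o → ℝ) : Prop :=
  ∀ i j : ℤ, 0 ≤ i + j + 1 →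
    z (i + 1) (j + 1) = O.F1 *ᵥ z i (j + 1) + O.F2 *ᵥ z (i + 1) j
      + O.K1 *ᵥ u i (j + 1) + O.K2 *ᵥ u (i + 1) j
      + O.E1 *ᵥ y i (j + 1) + O.E2 *ᵥ y (i + 1) j

/-- The estimate produced by the filter. -/
def estimate (O : Observer m q d) (y : ℤ → ℤ → Fin q → ℝ) (z : ℤ → ℤ → Fin O.o → ℝ)
    (i j : ℤ) : Fin d → ℝ :=
  O.G1 *ᵥ z i j + O.G2 *ᵥ y i j

end Observer

namespace Subsystem

variable {sys : FMII n m q} {S : Submodule ℝ (Fin n → ℝ)}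

/-- The 2D PBH matrix of the subsystem at a point of `ℂ²`. -/
noncomputable def pbh (Q : sys.Subsystem S) (z1 z2 : ℂ) : Matrix (Fin Q.d ⊕ Fin Q.s) (Fin Q.d) ℂ :=
  Matrix.fromRows
    (1 - z1 • Q.Ap1.map (algebraMap ℝ ℂ) - z2 • Q.Ap2.map (algebraMap ℝ ℂ))
    (Q.M.map (algebraMap ℝ ℂ))

/-- The PBH matrix is right zero prime: it has full column rank at every point of `ℂ²`. -/
def RightZeroPrime (Q : sys.Subsystem S) : Prop :=
  ∀ z1 z2 : ℂ, (Q.pbh z1 z2).rank = Q.d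

/-- The output selection `H` satisfies `ker HC = S + ker C`. -/
def OutputCondition (Q : sys.Subsystem S) : Prop :=
  LinearMap.ker (Q.H * sys.C).mulVecLin = S ⊔ LinearMap.ker sys.C.mulVecLin

/-- The residual `M ω̂ - H y` for the plant state `x` and the filter state `z`. -/
noncomputable def residual (Q : sys.Subsystem S) (O : Observer m q Q.d) (x : ℤ → ℤ → Fin n → ℝ)
    (z : ℤ → ℤ → Fin O.o → ℝ) (i j : ℤ) : Fin Q.s → ℝ :=
  Q.M *ᵥ O.estimate (fun a b => sys.C *ᵥ x a b) z i j - Q.H *ᵥ (sys.C *ᵥ x i j)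

/-- The fault signal `g` in the `k`-th fault is visible in the subsystem: the response of the
subsystem to it, from zero initial values and zero input, has a nonzero output somewhere. -/
def Visible (Q : sys.Subsystem S) (k : Fin 2) (g : ℤ → ℤ → ℝ) : Prop :=
  ∃ w : ℤ → ℤ → Fin Q.d → ℝ,
    (∀ i j : ℤ, i + j = 0 → w i j = 0) ∧
    (∀ i j : ℤ, 0 ≤ i + j + 1 →
      w (i + 1) (j + 1) = Q.Ap1 *ᵥ w i (j + 1) + Q.Ap2 *ᵥ w (i + 1) j
        + g i (j + 1) • (Q.P *ᵥ sys.L1 k) + g (i + 1) j • (Q.P *ᵥ sys.L2 k)) ∧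
    ∃ i j : ℤ, 0 ≤ i + j ∧ Q.M *ᵥ w i j ≠ 0

/-- First step, decoupling: the space factored out is the unobservable subspace of
`(HC, A1 + D1 C, A2 + D2 C)`; it contains the signatures of the other fault, but not all
signatures of the `k`-th fault. -/
def Isolates (Q : sys.Subsystem S) (k : Fin 2) : Prop :=
  S = sys.unobservable Q.D1 Q.D2 Q.H ∧ sys.faultSpace k.rev ≤ S ∧ ¬ sys.faultSpace k ≤ S

/-- Second step: `O` is an ordinary (non-delayed) deadbeat observer of the subsystem, with
transient `N`, whose residual detects the `k`-th fault and is decoupled from the other one. -/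
structure IsDeadbeatDetector (Q : sys.Subsystem S) (k : Fin 2) (O : Observer m q Q.d) (N : ℕ) :
    Prop where
  /-- Without the `k`-th fault the estimate equals the state of the subsystem after the transient,
  for all inputs, all other faults, and all initial values. -/
  deadbeat : ∀ u f x z, sys.IsTrajectory u f x →
    O.IsTrajectory u (fun a b => sys.C *ᵥ x a b) z →
    (∀ i j : ℤ, 0 ≤ i + j → f k i j = 0) →
    ∀ i j : ℤ, (N : ℤ) < i + j → O.estimate (fun a b => sys.C *ᵥ x a b) z i j = Q.P *ᵥ x i j
  /-- Without the `k`-th fault the residual vanishes after the transient. -/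
  residual_eq_zero : ∀ u f x z, sys.IsTrajectory u f x →
    O.IsTrajectory u (fun a b => sys.C *ᵥ x a b) z →
    (∀ i j : ℤ, 0 ≤ i + j → f k i j = 0) →
    ∀ i j : ℤ, (N : ℤ) < i + j → Q.residual O x z i j = 0
  /-- From zero initial values, every visible fault makes the residual nonzero. -/
  residual_ne_zero_of_rest : ∀ u f x z, sys.IsTrajectory u f x →
    O.IsTrajectory u (fun a b => sys.C *ᵥ x a b) z →
    (∀ i j : ℤ, i + j = 0 → x i j = 0 ∧ z i j = 0) →
    Q.Visible k (f k) → ∃ i j : ℤ, 0 ≤ i + j ∧ Q.residual O x z i j ≠ 0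
  /-- From any initial values, every visible fault that sets in after the transient makes the
  residual nonzero after the transient. -/
  residual_ne_zero : ∀ u f x z, sys.IsTrajectory u f x →
    O.IsTrajectory u (fun a b => sys.C *ᵥ x a b) z →
    (∀ i j : ℤ, 0 ≤ i + j → i + j ≤ (N : ℤ) → f k i j = 0) →
    Q.Visible k (f k) → ∃ i j : ℤ, (N : ℤ) < i + j ∧ Q.residual O x z i j ≠ 0

/-- Both steps are solved for the `k`-th fault through the subsystem `Q`, by an ordinary deadbeat
observer. -/
def DeadbeatSolves (Q : sys.Subsystem S) (k : Fin 2) : Prop :=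
  Q.Isolates k ∧ ∃ (O : Observer m q Q.d) (N : ℕ), Q.IsDeadbeatDetector k O N

end Subsystem

/-- The fault detection and isolation problem is solvable by ordinary deadbeat observers: for each
of the two faults both steps can be solved. -/
def FDISolvableByDeadbeat (sys : FMII n m q) : Prop :=
  ∀ k : Fin 2, ∃ (S : Submodule ℝ (Fin n → ℝ)) (Q : sys.Subsystem S), Q.DeadbeatSolves k

end FMII

/-- A matrix over a field whose rank is its number of columns has an invertible square submatrix
made of rows. -/
theorem Matrix.exists_isUnit_submatrix_of_rank_eq {K ι : Type*} [Field K] [Fintype ι] {d : ℕ}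
    (A : Matrix ι (Fin d) K) (h : A.rank = d) : ∃ g : Fin d → ι, IsUnit (A.submatrix g id) := by
  have key := Submodule.exists_fun_fin_finrank_span_eq K (Set.range A.row)
  rw [← Matrix.rank_eq_finrank_span_row, h] at key
  obtain ⟨f, hf, -, hli⟩ := key
  choose g hg using hf
  refine ⟨g, Matrix.linearIndependent_rows_iff_isUnit.1 ?_⟩
  rwa [show (A.submatrix g id).row = f from funext hg]

open MvPolynomial in
/-- A real polynomial matrix with full column rank at every complex point has a polynomial
left inverse. -/
theorem MvPolynomial.exists_left_inverse_of_rank_eq {σ ι : Type*} [Finite σ] [Fintype ι] {d : ℕ}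
    (A : Matrix ι (Fin d) (MvPolynomial σ ℝ))
    (h : ∀ x : σ → ℂ, (A.map (aeval x : MvPolynomial σ ℝ →ₐ[ℝ] ℂ)).rank = d) :
    ∃ B : Matrix (Fin d) ι (MvPolynomial σ ℝ), B * A = 1 := by
  classical
  let J : Ideal (MvPolynomial σ ℝ) :=
    { carrier := {r | ∃ B : Matrix (Fin d) ι (MvPolynomial σ ℝ), B * A = r • 1}
      zero_mem' := ⟨0, by simp⟩
      add_mem' := by
        rintro a b ⟨B, hB⟩ ⟨B', hB'⟩
        exact ⟨B + B', by rw [Matrix.add_mul, hB, hB', add_smul]⟩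
      smul_mem' := by
        rintro c a ⟨B, hB⟩
        exact ⟨c • B, by rw [Matrix.smul_mul, hB, smul_smul, smul_eq_mul]⟩ }
  by_cases hJ : J = ⊤
  · obtain ⟨B, hB⟩ : (1 : MvPolynomial σ ℝ) ∈ J := by rw [hJ]; trivial
    exact ⟨B, by rw [hB, one_smul]⟩
  exfalso
  obtain ⟨I, hI, hJI⟩ := Ideal.exists_le_maximal J hJ
  obtain ⟨x, rfl⟩ := eq_vanishingIdeal_singleton_of_isMaximal ℂ hI
  obtain ⟨g, hg⟩ := Matrix.exists_isUnit_submatrix_of_rank_eq _ (h x)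
  have hdet : (A.submatrix g id).det ∈ J := by
    refine ⟨(A.submatrix g id).adjugate * (1 : Matrix ι ι (MvPolynomial σ ℝ)).submatrix g id, ?_⟩
    rw [Matrix.mul_assoc]
    have : (1 : Matrix ι ι (MvPolynomial σ ℝ)).submatrix g id * A = A.submatrix g id := by
      ext i j : 2
      simp [Matrix.mul_apply, Matrix.one_apply]
    rw [this, Matrix.adjugate_mul]
  have h0 := hJI hdet x rfl
  rw [AlgHom.map_det] at h0
  rw [Matrix.isUnit_iff_isUnit_det] at hg
  exact hg.ne_zero h0

/-- A real matrix as a constant polynomial matrix. -/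
noncomputable abbrev Matrix.constPoly {α β : Type*} (A : Matrix α β ℝ) :
    Matrix α β (MvPolynomial (Fin 2) ℝ) :=
  A.map MvPolynomial.C

open MvPolynomial in
/-- The polynomial matrix `I - z₁ A₁ - z₂ A₂`. -/
noncomputable def Matrix.pencil {d : ℕ} (A1 A2 : Matrix (Fin d) (Fin d) ℝ) :
    Matrix (Fin d) (Fin d) (MvPolynomial (Fin 2) ℝ) :=
  1 - (X 0 : MvPolynomial (Fin 2) ℝ) • A1.constPoly - (X 1 : MvPolynomial (Fin 2) ℝ) • A2.constPoly

open MvPolynomial in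
/-- Polynomial Bézout identity for a right zero prime pair, with strictly causal second factor. -/
theorem Matrix.exists_bezout_of_rank_eq {d s : ℕ} (A1 A2 : Matrix (Fin d) (Fin d) ℝ)
    (M : Matrix (Fin s) (Fin d) ℝ)
    (h : ∀ z1 z2 : ℂ, (Matrix.fromRows
      (1 - z1 • A1.map (algebraMap ℝ ℂ) - z2 • A2.map (algebraMap ℝ ℂ))
      (M.map (algebraMap ℝ ℂ))).rank = d) :
    ∃ (U : Matrix (Fin d) (Fin d) (MvPolynomial (Fin 2) ℝ))
      (V : Matrix (Fin d) (Fin s) (MvPolynomial (Fin 2) ℝ)),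
      U * Matrix.pencil A1 A2 + V * M.constPoly = 1 ∧ ∀ i j, constantCoeff (V i j) = 0 := by
  obtain ⟨B, hB⟩ := exists_left_inverse_of_rank_eq
    (Matrix.fromRows (Matrix.pencil A1 A2) M.constPoly) (by
      intro x
      refine Eq.trans (congrArg Matrix.rank ?_) (h (x 0) (x 1))
      ext i j
      rcases i with i | i
      · simp [Matrix.pencil, Matrix.one_apply, apply_ite (aeval x)]
      · simp)
  obtain ⟨U, V, rfl⟩ : ∃ U V, B = Matrix.fromCols U V :=
    ⟨_, _, (Matrix.fromCols_toCols B).symm⟩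
  rw [Matrix.fromCols_mul_fromRows] at hB
  set W := Matrix.pencil A1 A2 with hW
  set M' : Matrix (Fin s) (Fin d) (MvPolynomial (Fin 2) ℝ) := M.constPoly with hM'
  let Q : Matrix (Fin d) (Fin s) (MvPolynomial (Fin 2) ℝ) :=
    V.map fun p => C (constantCoeff p)
  have hQ (D : MvPolynomial (Fin 2) ℝ) (N : Matrix (Fin d) (Fin d) (MvPolynomial (Fin 2) ℝ))
      (hN : N * W = D • 1) : (U + Q * M' * N) * W + (V - D • Q) * M' = 1 := by
    rw [Matrix.add_mul, Matrix.sub_mul, Matrix.mul_assoc (Q * M'), hN, Matrix.mul_smul, Matrix.mul_one,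
      Matrix.smul_mul, ← hB]
    abel
  have hW0 : constantCoeff.mapMatrix W = 1 := by
    ext a b
    simp [hW, Matrix.pencil, Matrix.one_apply, apply_ite constantCoeff]
  have hdet : constantCoeff W.det = 1 := by
    rw [RingHom.map_det, hW0, Matrix.det_one]
  refine ⟨_, _, hQ W.det W.adjugate W.adjugate_mul, fun i j => ?_⟩
  simp [Q, hdet]

/-- The delay `z₁ ^ (μ 0) z₂ ^ (μ 1)` on scalar signals over `ℤ²`. -/
def delayEnd (μ : Fin 2 →₀ ℕ) : Module.End ℝ (ℤ → ℤ → ℝ) where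
  toFun s i j := s (i - μ 0) (j - μ 1)
  map_add' _ _ := rfl
  map_smul' _ _ := rfl

@[simp] theorem delayEnd_apply (μ : Fin 2 →₀ ℕ) (s : ℤ → ℤ → ℝ) (i j : ℤ) :
    delayEnd μ s i j = s (i - μ 0) (j - μ 1) := rfl

/-- Real polynomials in two indeterminates as delay operators on scalar signals. -/
noncomputable def delayPoly : MvPolynomial (Fin 2) ℝ →ₐ[ℝ] Module.End ℝ (ℤ → ℤ → ℝ) :=
  AddMonoidAlgebra.lift ℝ _ (Fin 2 →₀ ℕ)
    { toFun := fun μ => delayEnd μ.toAdd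
      map_one' := by ext s i j; simp
      map_mul' := fun μ ν => by
        ext s i j
        simp only [toAdd_mul, delayEnd_apply, Finsupp.add_apply, Module.End.mul_apply]
        push_cast
        congr 1 <;> ring }

theorem delayPoly_monomial (μ : Fin 2 →₀ ℕ) (c : ℝ) :
    delayPoly (MvPolynomial.monomial μ c) = c • delayEnd μ :=
  AddMonoidAlgebra.lift_single _ _ _

theorem delayPoly_X (k : Fin 2) :
    delayPoly (MvPolynomial.X k) = delayEnd (Finsupp.single k 1) := by
  rw [MvPolynomial.X, delayPoly_monomial, one_smul]

theorem delayPoly_apply (p : MvPolynomial (Fin 2) ℝ) (s : ℤ → ℤ → ℝ) (i j : ℤ) :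
    delayPoly p s i j = ∑ μ ∈ p.support, p.coeff μ * s (i - μ 0) (j - μ 1) := by
  conv_lhs => rw [p.as_sum]
  rw [map_sum]
  simp [delayPoly_monomial, LinearMap.sum_apply, Finset.sum_apply]

/-- A polynomial matrix as an operator on vector signals. -/
noncomputable def delayOp {α β : Type*} [Fintype β] (T : Matrix α β (MvPolynomial (Fin 2) ℝ))
    (v : ℤ → ℤ → β → ℝ) (i j : ℤ) (a : α) : ℝ :=
  ∑ b, delayPoly (T a b) (fun i j => v i j b) i j

section delayOp

variable {α β γ : Type*} [Fintype β] [Fintype γ]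

theorem delayOp_mul (T : Matrix α β (MvPolynomial (Fin 2) ℝ))
    (T' : Matrix β γ (MvPolynomial (Fin 2) ℝ)) (v : ℤ → ℤ → γ → ℝ) :
    delayOp (T * T') v = delayOp T (delayOp T' v) := by
  funext i j a
  have (b : β) : (fun i j => delayOp T' v i j b)
      = ∑ c, delayPoly (T' b c) (fun i j => v i j c) := by
    funext i j; simp [delayOp, Finset.sum_apply]
  simp only [delayOp.eq_1 T, this]
  simp only [delayOp, Matrix.mul_apply, map_sum, map_mul, LinearMap.sum_apply,
    Finset.sum_apply, Module.End.mul_apply]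
  exact Finset.sum_comm

theorem delayOp_add (T T' : Matrix α β (MvPolynomial (Fin 2) ℝ)) (v : ℤ → ℤ → β → ℝ) :
    delayOp (T + T') v = delayOp T v + delayOp T' v := by
  funext i j a
  simp [delayOp, Finset.sum_add_distrib]

theorem delayOp_sub (T T' : Matrix α β (MvPolynomial (Fin 2) ℝ)) (v : ℤ → ℤ → β → ℝ) :
    delayOp (T - T') v = delayOp T v - delayOp T' v := by
  funext i j a
  simp [delayOp, Finset.sum_sub_distrib]

theorem delayOp_signal_add (T : Matrix α β (MvPolynomial (Fin 2) ℝ)) (v w : ℤ → ℤ → β → ℝ) :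
    delayOp T (v + w) = delayOp T v + delayOp T w := by
  funext i j a
  simp only [delayOp, Pi.add_apply, ← Finset.sum_add_distrib]
  refine Finset.sum_congr rfl fun b _ => ?_
  exact congrFun (congrFun (map_add (delayPoly (T a b)) (fun i j => v i j b)
    (fun i j => w i j b)) i) j

theorem delayOp_C (A : Matrix α β ℝ) (v : ℤ → ℤ → β → ℝ) (i j : ℤ) :
    delayOp (A.constPoly) v i j = A *ᵥ v i j := by
  funext a
  simp only [delayOp, Matrix.map_apply, MvPolynomial.C_apply, delayPoly_monomial, Matrix.mulVec,
    dotProduct]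
  simp

theorem delayOp_one [DecidableEq β] (v : ℤ → ℤ → β → ℝ) : delayOp 1 v = v := by
  funext i j
  have := delayOp_C (1 : Matrix β β ℝ) v i j
  rwa [Matrix.constPoly, Matrix.map_one _ (map_zero _) (map_one _), Matrix.one_mulVec] at this

theorem delayOp_X_zero (A : Matrix α β ℝ) (v : ℤ → ℤ → β → ℝ) (i j : ℤ) :
    delayOp ((MvPolynomial.X 0 : MvPolynomial (Fin 2) ℝ) • A.constPoly) v i j
      = A *ᵥ v (i - 1) j := by
  funext a
  simp only [delayOp, Matrix.smul_apply, Matrix.map_apply, smul_eq_mul, map_mul, delayPoly_X,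
    MvPolynomial.C_apply, delayPoly_monomial, Matrix.mulVec, dotProduct]
  simp

theorem delayOp_X_one (A : Matrix α β ℝ) (v : ℤ → ℤ → β → ℝ) (i j : ℤ) :
    delayOp ((MvPolynomial.X 1 : MvPolynomial (Fin 2) ℝ) • A.constPoly) v i j
      = A *ᵥ v i (j - 1) := by
  funext a
  simp only [delayOp, Matrix.smul_apply, Matrix.map_apply, smul_eq_mul, map_mul, delayPoly_X,
    MvPolynomial.C_apply, delayPoly_monomial, Matrix.mulVec, dotProduct]
  simp

theorem delayOp_pencil {d : ℕ} (A1 A2 : Matrix (Fin d) (Fin d) ℝ)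
    (w : ℤ → ℤ → Fin d → ℝ) (i j : ℤ) :
    delayOp (Matrix.pencil A1 A2) w i j = w i j - A1 *ᵥ w (i - 1) j - A2 *ᵥ w i (j - 1) := by
  rw [Matrix.pencil, delayOp_sub, delayOp_sub, delayOp_one, Pi.sub_apply, Pi.sub_apply,
    Pi.sub_apply, Pi.sub_apply, delayOp_X_zero, delayOp_X_one]

/-- The value of `T v` at a point depends on finitely many past values of `v` only. -/
theorem exists_delayOp_congr [Finite α] (T : Matrix α β (MvPolynomial (Fin 2) ℝ)) :
    ∃ N : ℕ, ∀ (v w : ℤ → ℤ → β → ℝ) (i j : ℤ),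
      (∀ a b : ℤ, i + j - N ≤ a + b → a + b ≤ i + j → v a b = w a b) →
        delayOp T v i j = delayOp T w i j := by
  cases nonempty_fintype α
  refine ⟨Finset.univ.sup fun a => Finset.univ.sup fun b => (T a b).totalDegree,
    fun v w i j h => ?_⟩
  funext a
  refine Finset.sum_congr rfl fun b _ => ?_
  rw [delayPoly_apply, delayPoly_apply]
  refine Finset.sum_congr rfl fun μ hμ => ?_
  have h1 := MvPolynomial.le_totalDegree hμ
  have h2 : (T a b).totalDegree ≤
      Finset.univ.sup fun a => Finset.univ.sup fun b => (T a b).totalDegree :=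
    (Finset.le_sup (f := fun b => (T a b).totalDegree) (Finset.mem_univ b)).trans
      (Finset.le_sup (f := fun a => Finset.univ.sup fun b => (T a b).totalDegree)
        (Finset.mem_univ a))
  rw [Finsupp.sum_fintype _ _ (fun _ => rfl), Fin.sum_univ_two] at h1
  rw [h _ _ (by omega) (by omega)]

/-- If `T` has no constant term, then `T v` vanishes up to the time after the past of `v` does. -/
theorem delayOp_eq_zero_of_strict (T : Matrix α β (MvPolynomial (Fin 2) ℝ))
    (hT : ∀ a b, MvPolynomial.constantCoeff (T a b) = 0) (v : ℤ → ℤ → β → ℝ) (i j : ℤ)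
    (hv : ∀ a b : ℤ, a + b < i + j → v a b = 0) : delayOp T v i j = 0 := by
  funext a
  refine Finset.sum_eq_zero fun b _ => ?_
  rw [delayPoly_apply]
  refine Finset.sum_eq_zero fun μ hμ => ?_
  have h0 : μ ≠ 0 := by
    rintro rfl
    exact MvPolynomial.mem_support_iff.1 hμ (hT a b)
  have h1 : 0 < μ 0 + μ 1 := by
    by_contra hc
    apply h0
    ext k
    fin_cases k <;> simp <;> omega
  rw [hv _ _ (by omega)]
  simp

theorem delayOp_eq_zero_of_past (T : Matrix α β (MvPolynomial (Fin 2) ℝ))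
    (v : ℤ → ℤ → β → ℝ) (i j : ℤ)
    (hv : ∀ a b : ℤ, a + b ≤ i + j → v a b = 0) : delayOp T v i j = 0 := by
  funext a
  refine Finset.sum_eq_zero fun b _ => ?_
  rw [delayPoly_apply]
  refine Finset.sum_eq_zero fun μ hμ => ?_
  rw [hv _ _ (by omega)]
  simp

/-- A signal with a beginning that is reproduced by a strictly causal operator vanishes. -/
theorem eq_zero_of_delayOp_eq_self (T : Matrix β β (MvPolynomial (Fin 2) ℝ))
    (hT : ∀ a b, MvPolynomial.constantCoeff (T a b) = 0) (v : ℤ → ℤ → β → ℝ)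
    (h0 : ∀ i j : ℤ, i + j < 0 → v i j = 0) (h : delayOp T v = v) : v = 0 := by
  have key : ∀ n : ℕ, ∀ i j : ℤ, i + j < n → v i j = 0 := by
    intro n
    induction n with
    | zero => simpa using h0
    | succ n ih =>
      intro i j hij
      rw [← h]
      exact delayOp_eq_zero_of_strict T hT v i j fun a b hab => ih a b (by push_cast at hij; omega)
  funext i j
  exact key ((i + j).toNat + 1) i j (by push_cast; have := Int.self_le_toNat (i + j); omega)

end delayOp

theorem delayPoly_apply_eq_add_sum (p : MvPolynomial (Fin 2) ℝ) (K : Fin 2 →₀ ℕ)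
    (hK : ∀ μ ∈ p.support, μ ≤ K) (s : ℤ → ℤ → ℝ) (i j : ℤ) :
    delayPoly p s i j = MvPolynomial.constantCoeff p * s i j
      + ∑ μ : Finset.Iic K, (if μ.1 = 0 then 0 else p.coeff μ.1)
        * s (i - μ.1 0) (j - μ.1 1) := by
  rw [delayPoly_apply, Finset.sum_subset (s₂ := Finset.Iic K)
      (fun μ hμ => Finset.mem_Iic.2 (hK μ hμ))
      (fun μ _ hμ => by rw [MvPolynomial.notMem_support_iff.1 hμ, zero_mul]),
    Finset.sum_coe_sort (Finset.Iic K) (fun μ => (if μ = 0 then 0 else p.coeff μ)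
      * s (i - μ 0) (j - μ 1)),
    ← Finset.add_sum_erase _ _ (Finset.mem_Iic.2 (zero_le (a := K))),
    ← Finset.add_sum_erase (Finset.Iic K) (fun μ => (if μ = 0 then 0 else p.coeff μ)
      * s (i - μ 0) (j - μ 1)) (Finset.mem_Iic.2 (zero_le (a := K)))]
  simp only [if_true, zero_mul, zero_add, MvPolynomial.constantCoeff_eq]
  congr 1
  · simp
  · exact Finset.sum_congr rfl fun μ hμ => by rw [if_neg (Finset.ne_of_mem_erase hμ)]

section delayLine

variable (K : Fin 2 →₀ ℕ) (χ : Type*)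

/-- Shift of the registers of a two-dimensional delay line along the first axis. -/
noncomputable def delayLineF1 : (Finset.Iic K × χ → ℝ) →ₗ[ℝ] (Finset.Iic K × χ → ℝ) where
  toFun z p := if p.1.1 0 ≠ 0 ∧ p.1.1 ≠ Finsupp.single 0 1 then
    z (⟨p.1.1 - Finsupp.single 0 1,
      Finset.mem_Iic.2 (tsub_le_self.trans (Finset.mem_Iic.1 p.1.2))⟩, p.2) else 0
  map_add' z z' := by funext p; dsimp only [Pi.add_apply]; split_ifs <;> simp
  map_smul' c z := by funext p; dsimp only [Pi.smul_apply]; split_ifs <;> simp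

/-- Shift of the registers of a two-dimensional delay line along the second axis. -/
noncomputable def delayLineF2 : (Finset.Iic K × χ → ℝ) →ₗ[ℝ] (Finset.Iic K × χ → ℝ) where
  toFun z p := if p.1.1 0 = 0 ∧ p.1.1 ≠ Finsupp.single 1 1 then
    z (⟨p.1.1 - Finsupp.single 1 1,
      Finset.mem_Iic.2 (tsub_le_self.trans (Finset.mem_Iic.1 p.1.2))⟩, p.2) else 0
  map_add' z z' := by funext p; dsimp only [Pi.add_apply]; split_ifs <;> simp
  map_smul' c z := by funext p; dsimp only [Pi.smul_apply]; split_ifs <;> simp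

/-- Feeding a signal into the register with delay `μ` of a two-dimensional delay line. -/
noncomputable def delayLineInput (μ : Fin 2 →₀ ℕ) : (χ → ℝ) →ₗ[ℝ] (Finset.Iic K × χ → ℝ) where
  toFun v p := if p.1.1 = μ then v p.2 else 0
  map_add' z z' := by funext p; dsimp only [Pi.add_apply]; split_ifs <;> simp
  map_smul' c z := by funext p; dsimp only [Pi.smul_apply]; split_ifs <;> simp

variable {K χ}

/-- After a transient the registers of a delay line hold the delayed input. -/
theorem delayLine_eq (z : ℤ → ℤ → Finset.Iic K × χ → ℝ) (v : ℤ → ℤ → χ → ℝ)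
    (h : ∀ i j : ℤ, 0 ≤ i + j + 1 → z (i + 1) (j + 1) =
      delayLineF1 K χ (z i (j + 1)) + delayLineF2 K χ (z (i + 1) j)
        + delayLineInput K χ (Finsupp.single 0 1) (v i (j + 1))
        + delayLineInput K χ (Finsupp.single 1 1) (v (i + 1) j)) (c : χ) :
    ∀ (n : ℕ) (μ : Fin 2 →₀ ℕ) (hμ : μ ∈ Finset.Iic K), μ ≠ 0 → μ 0 + μ 1 = n →
      ∀ i j : ℤ, (n : ℤ) ≤ i + j → z i j (⟨μ, hμ⟩, c) = v (i - μ 0) (j - μ 1) c := by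
  intro n
  induction n with
  | zero =>
    intro μ hμ h0 hn
    exact absurd (by ext k; fin_cases k <;> simp <;> omega) h0
  | succ n ih =>
    intro μ hμ h0 hn i j hij
    push_cast at hij
    have hz := congrFun (h (i - 1) (j - 1) (by omega)) (⟨μ, hμ⟩, c)
    simp only [sub_add_cancel, Pi.add_apply, delayLineF1, delayLineF2, delayLineInput,
      LinearMap.coe_mk, AddHom.coe_mk] at hz
    rw [hz]
    by_cases h1 : μ 0 = 0
    · have hne : μ ≠ Finsupp.single 0 1 := by rintro rfl; simp at h1
      by_cases h2 : μ = Finsupp.single 1 1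
      · subst h2
        simp [hne]
      · have e0 : (μ - Finsupp.single 1 1 : Fin 2 →₀ ℕ) 0 = μ 0 := by simp
        have e1 : (μ - Finsupp.single 1 1 : Fin 2 →₀ ℕ) 1 = μ 1 - 1 := by simp
        have h3 : (μ - Finsupp.single 1 1 : Fin 2 →₀ ℕ) ≠ 0 := by
          intro h3
          rw [h3, Finsupp.zero_apply] at e1
          apply h2
          ext k
          fin_cases k
          · simpa using h1
          · simp only [Fin.mk_one, Finsupp.single_eq_same]
            omega
        have := ih (μ - Finsupp.single 1 1)
          (Finset.mem_Iic.2 (tsub_le_self.trans (Finset.mem_Iic.1 hμ))) h3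
          (by rw [e0, e1]; omega) i (j - 1) (by omega)
        rw [e0, e1, show j - 1 - ((μ 1 - 1 : ℕ) : ℤ) = j - μ 1 by omega] at this
        simp only [h1, ne_eq, not_true_eq_false, false_and, if_false, h2, not_false_eq_true,
          and_self, if_true, this, hne, add_zero, zero_add]
    · have hne : μ ≠ Finsupp.single 1 1 := by rintro rfl; simp at h1
      by_cases h2 : μ = Finsupp.single 0 1
      · subst h2
        simp [hne]
      · have e0 : (μ - Finsupp.single 0 1 : Fin 2 →₀ ℕ) 0 = μ 0 - 1 := by simp
        have e1 : (μ - Finsupp.single 0 1 : Fin 2 →₀ ℕ) 1 = μ 1 := by simp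
        have h3 : (μ - Finsupp.single 0 1 : Fin 2 →₀ ℕ) ≠ 0 := by
          intro h3
          rw [h3, Finsupp.zero_apply] at e0 e1
          apply h2
          ext k
          fin_cases k
          · simp only [Fin.zero_eta, Finsupp.single_eq_same]
            omega
          · simpa using e1.symm
        have := ih (μ - Finsupp.single 0 1)
          (Finset.mem_Iic.2 (tsub_le_self.trans (Finset.mem_Iic.1 hμ))) h3
          (by rw [e0, e1]; omega) (i - 1) j (by omega)
        rw [e0, e1, show i - 1 - ((μ 0 - 1 : ℕ) : ℤ) = i - μ 0 by omega] at this
        simp only [h1, ne_eq, false_and, if_false, h2, not_false_eq_true,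
          and_self, if_true, this, hne, add_zero]

end delayLine

open MvPolynomial in
/-- Every polynomial operator that is strictly causal in `u` is realized, after a transient, by a
filter. -/
theorem FMII.Observer.exists_estimate_eq {m q d : ℕ}
    (Tu : Matrix (Fin d) (Fin m) (MvPolynomial (Fin 2) ℝ))
    (Ty : Matrix (Fin d) (Fin q) (MvPolynomial (Fin 2) ℝ))
    (hTu : ∀ a b, constantCoeff (Tu a b) = 0) :
    ∃ (O : FMII.Observer m q d) (N : ℕ), ∀ u y z, O.IsTrajectory u y z →
      ∀ i j : ℤ, (N : ℤ) ≤ i + j →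
        O.estimate y z i j = delayOp Tu u i j + delayOp Ty y i j := by
  classical
  let K : Fin 2 →₀ ℕ :=
    (Finset.univ.sup fun p : Fin d × Fin m => (Tu p.1 p.2).support.sup id) ⊔
      (Finset.univ.sup fun p : Fin d × Fin q => (Ty p.1 p.2).support.sup id)
  have hKu (a b) : ∀ μ ∈ (Tu a b).support, μ ≤ K := fun μ hμ =>
    (Finset.le_sup (f := id) hμ).trans ((Finset.le_sup
      (f := fun p : Fin d × Fin m => (Tu p.1 p.2).support.sup id)
      (Finset.mem_univ (a, b))).trans le_sup_left)
  have hKy (a b) : ∀ μ ∈ (Ty a b).support, μ ≤ K := fun μ hμ =>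
    (Finset.le_sup (f := id) hμ).trans ((Finset.le_sup
      (f := fun p : Fin d × Fin q => (Ty p.1 p.2).support.sup id)
      (Finset.mem_univ (a, b))).trans le_sup_right)
  let e := Fintype.equivFin (Finset.Iic K × (Fin m ⊕ Fin q))
  let toFin := LinearMap.funLeft ℝ ℝ e.symm
  let ofFin := LinearMap.funLeft ℝ ℝ e
  let inl : (Fin m → ℝ) →ₗ[ℝ] ((Fin m ⊕ Fin q) → ℝ) :=
    (LinearEquiv.sumArrowLequivProdArrow (Fin m) (Fin q) ℝ ℝ).symm.toLinearMap ∘ₗ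
      LinearMap.inl ℝ _ _
  let inr : (Fin q → ℝ) →ₗ[ℝ] ((Fin m ⊕ Fin q) → ℝ) :=
    (LinearEquiv.sumArrowLequivProdArrow (Fin m) (Fin q) ℝ ℝ).symm.toLinearMap ∘ₗ
      LinearMap.inr ℝ _ _
  let T : Matrix (Fin d) (Fin m ⊕ Fin q) (MvPolynomial (Fin 2) ℝ) := Matrix.fromCols Tu Ty
  let O : FMII.Observer m q d :=
    { o := Fintype.card (Finset.Iic K × (Fin m ⊕ Fin q))
      F1 := LinearMap.toMatrix' (toFin ∘ₗ delayLineF1 K (Fin m ⊕ Fin q) ∘ₗ ofFin)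
      F2 := LinearMap.toMatrix' (toFin ∘ₗ delayLineF2 K (Fin m ⊕ Fin q) ∘ₗ ofFin)
      K1 := LinearMap.toMatrix' (toFin ∘ₗ delayLineInput K (Fin m ⊕ Fin q) (Finsupp.single 0 1) ∘ₗ inl)
      K2 := LinearMap.toMatrix' (toFin ∘ₗ delayLineInput K (Fin m ⊕ Fin q) (Finsupp.single 1 1) ∘ₗ inl)
      E1 := LinearMap.toMatrix' (toFin ∘ₗ delayLineInput K (Fin m ⊕ Fin q) (Finsupp.single 0 1) ∘ₗ inr)
      E2 := LinearMap.toMatrix' (toFin ∘ₗ delayLineInput K (Fin m ⊕ Fin q) (Finsupp.single 1 1) ∘ₗ inr)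
      G1 := Matrix.of fun a k => if (e.symm k).1.1 = 0 then 0 else
        (T a (e.symm k).2).coeff (e.symm k).1.1
      G2 := Matrix.of fun a b => constantCoeff (Ty a b) }
  refine ⟨O, K 0 + K 1, fun u y z hz i j hij => ?_⟩
  let v : ℤ → ℤ → (Fin m ⊕ Fin q) → ℝ := fun i j => inl (u i j) + inr (y i j)
  have hreg := delayLine_eq (fun i j => ofFin (z i j)) v (fun i j h => by
    rw [hz i j h]
    have hinv (g : Finset.Iic K × (Fin m ⊕ Fin q) → ℝ) : ofFin (toFin g) = g := by
      funext p; simp [ofFin, toFin, LinearMap.funLeft_apply]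
    simp only [O, LinearMap.toMatrix'_mulVec, LinearMap.comp_apply, map_add, hinv, v]
    abel)
  have hreg' (μ : Finset.Iic K) (c : (Fin m ⊕ Fin q)) (h0 : μ.1 ≠ 0) :
      z i j (e (μ, c)) = v (i - μ.1 0) (j - μ.1 1) c := by
    refine hreg c _ μ.1 μ.2 h0 rfl i j (le_trans ?_ hij)
    have := Finset.mem_Iic.1 μ.2
    have h1 := this 0
    have h2 := this 1
    push_cast
    omega
  funext a
  have hG1 : (O.G1 *ᵥ z i j) a = ∑ c, ∑ μ : Finset.Iic K,
      (if μ.1 = 0 then 0 else (T a c).coeff μ.1) * v (i - μ.1 0) (j - μ.1 1) c := by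
    rw [Finset.sum_comm, ← Fintype.sum_prod_type']
    refine Fintype.sum_equiv e.symm _ _ fun k => ?_
    simp only [O, Matrix.of_apply]
    split_ifs with h0
    · simp
    · rw [← hreg' _ _ h0]
      simp
  have hvu (i j : ℤ) (b : Fin m) : v i j (Sum.inl b) = u i j b := by simp [v, inl, inr]
  have hvy (i j : ℤ) (b : Fin q) : v i j (Sum.inr b) = y i j b := by simp [v, inl, inr]
  have hest : O.estimate y z i j a = (O.G1 *ᵥ z i j) a + (O.G2 *ᵥ y i j) a := rfl
  rw [hest, hG1]
  simp only [Pi.add_apply, Fintype.sum_sum_type, T,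
    Matrix.fromCols_apply_inl, Matrix.fromCols_apply_inr, hvu, hvy, delayOp,
    delayPoly_apply_eq_add_sum _ K (hKu _ _), delayPoly_apply_eq_add_sum _ K (hKy _ _), hTu,
    zero_mul, zero_add, Finset.sum_add_distrib, O, Matrix.mulVec, dotProduct, Matrix.of_apply]
  ring

namespace FMII

variable {n m q : ℕ}

/-- The largest invariant subspace lies in the given subspace and is invariant. -/
theorem largestInvariant_mem {K : Submodule ℝ (Fin n → ℝ)} {A1 A2 : Matrix (Fin n) (Fin n) ℝ} :
    largestInvariant K A1 A2 ≤ K ∧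
      (largestInvariant K A1 A2).map A1.mulVecLin ≤ largestInvariant K A1 A2 ∧
      (largestInvariant K A1 A2).map A2.mulVecLin ≤ largestInvariant K A1 A2 := by
  refine ⟨sSup_le fun V hV => hV.1, ?_, ?_⟩
  · rw [largestInvariant, sSup_eq_iSup, Submodule.map_iSup]
    simp only [Submodule.map_iSup]
    exact iSup₂_le fun V hV => hV.2.1.trans (le_iSup₂_of_le V hV le_rfl)
  · rw [largestInvariant, sSup_eq_iSup, Submodule.map_iSup]
    simp only [Submodule.map_iSup]
    exact iSup₂_le fun V hV => hV.2.2.trans (le_iSup₂_of_le V hV le_rfl)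

theorem le_largestInvariant {K V : Submodule ℝ (Fin n → ℝ)} {A1 A2 : Matrix (Fin n) (Fin n) ℝ}
    (h : V ≤ K) (h1 : V.map A1.mulVecLin ≤ V) (h2 : V.map A2.mulVecLin ≤ V) :
    V ≤ largestInvariant K A1 A2 :=
  le_sSup ⟨h, h1, h2⟩

variable {sys : FMII n m q} {S : Submodule ℝ (Fin n → ℝ)}

/-- If `V ≤ S ⊔ ker C` contains `S`, and `S` and `V` are invariant under different output
injections of the same matrix, then `V` is invariant under the injection that leaves `S`
invariant. -/
theorem map_le_of_outputInjection {V : Submodule ℝ (Fin n → ℝ)} {A : Matrix (Fin n) (Fin n) ℝ}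
    {C : Matrix (Fin q) (Fin n) ℝ} {D D' : Matrix (Fin n) (Fin q) ℝ}
    (hSV : S ≤ V) (hV : V ≤ S ⊔ LinearMap.ker C.mulVecLin)
    (hS : S.map (A + D' * C).mulVecLin ≤ S) (hVA : V.map (A + D * C).mulVecLin ≤ V) :
    V.map (A + D' * C).mulVecLin ≤ V := by
  rintro _ ⟨v, hv, rfl⟩
  obtain ⟨s, hs, c, hc, rfl⟩ := Submodule.mem_sup.1 (hV hv)
  have hcV : c ∈ V := by simpa using V.sub_mem hv (hSV hs)
  have hc0 : C *ᵥ c = 0 := hc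
  have h1 : (A + D' * C).mulVecLin c = (A + D * C).mulVecLin c := by
    simp only [Matrix.mulVecLin_apply, Matrix.add_mulVec, ← Matrix.mulVec_mulVec, hc0,
      Matrix.mulVec_zero]
  rw [map_add, h1]
  exact V.add_mem (hSV (hS ⟨s, hs, rfl⟩)) (hVA ⟨c, hcV, rfl⟩)

namespace Subsystem

theorem map_le_of_mul_eq (Q : sys.Subsystem S) {A : Matrix (Fin n) (Fin n) ℝ}
    {A' : Matrix (Fin Q.d) (Fin Q.d) ℝ} (h : A' * Q.P = Q.P * A) : S.map A.mulVecLin ≤ S := by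
  rintro _ ⟨v, hv, rfl⟩
  rw [SetLike.mem_coe, ← Q.ker_P, LinearMap.mem_ker, Matrix.mulVecLin_apply] at hv
  rw [← Q.ker_P, LinearMap.mem_ker, Matrix.mulVecLin_apply, Matrix.mulVecLin_apply,
    Matrix.mulVec_mulVec, ← h, ← Matrix.mulVec_mulVec, hv, Matrix.mulVec_zero]

/-- Under the output condition, the unobservability subspace that is factored out is the
unobservable subspace of the output injections and the output selection of the quotient. -/
theorem eq_unobservable (Q : sys.Subsystem S) (hS : sys.IsUnobservability S)
    (hQ : Q.OutputCondition) : S = sys.unobservable Q.D1 Q.D2 Q.H := by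
  have hSV : S ≤ sys.unobservable Q.D1 Q.D2 Q.H :=
    le_largestInvariant (hQ ▸ le_sup_left) (Q.map_le_of_mul_eq Q.Ap1_mul)
      (Q.map_le_of_mul_eq Q.Ap2_mul)
  refine le_antisymm hSV ?_
  obtain ⟨s, D1, D2, H, hSeq⟩ := hS
  obtain ⟨hS0, hS1, hS2⟩ := largestInvariant_mem (K := LinearMap.ker (H * sys.C).mulVecLin)
    (A1 := sys.A1 + D1 * sys.C) (A2 := sys.A2 + D2 * sys.C)
  rw [← unobservable, ← hSeq] at hS0 hS1 hS2
  obtain ⟨hV0, hV1, hV2⟩ := largestInvariant_mem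
    (K := LinearMap.ker (Q.H * sys.C).mulVecLin)
    (A1 := sys.A1 + Q.D1 * sys.C) (A2 := sys.A2 + Q.D2 * sys.C)
  have hV : sys.unobservable Q.D1 Q.D2 Q.H ≤ S ⊔ LinearMap.ker sys.C.mulVecLin := hQ ▸ hV0
  have hker : LinearMap.ker sys.C.mulVecLin ≤ LinearMap.ker (H * sys.C).mulVecLin := by
    intro c hc
    have hc0 : sys.C *ᵥ c = 0 := hc
    simp [hc0]
  conv_rhs => rw [hSeq]
  exact le_largestInvariant (hV.trans (sup_le hS0 hker))
    (map_le_of_outputInjection hSV hV hS1 hV1) (map_le_of_outputInjection hSV hV hS2 hV2)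

/-- The contribution of the signal `g` in the `k`-th fault to the state of the subsystem. -/
def faultInput (Q : sys.Subsystem S) (k : Fin 2) (g : ℤ → ℤ → ℝ) (i j : ℤ) : Fin Q.d → ℝ :=
  g (i - 1) j • (Q.P *ᵥ sys.L1 k) + g i (j - 1) • (Q.P *ᵥ sys.L2 k)

/-- The image of a state trajectory satisfies the equation of the subsystem. -/
theorem pencil_mulVec_eq (Q : sys.Subsystem S) {k : Fin 2} (hk : sys.faultSpace k.rev ≤ S)
    {u f x} (hx : sys.IsTrajectory u f x) {i j : ℤ} (hij : 1 ≤ i + j) :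
    delayOp (Matrix.pencil Q.Ap1 Q.Ap2) (fun i j => Q.P *ᵥ x i j) i j =
      (Q.P * sys.B1) *ᵥ u (i - 1) j + (Q.P * sys.B2) *ᵥ u i (j - 1)
        - ((Q.P * Q.D1) *ᵥ (sys.C *ᵥ x (i - 1) j) + (Q.P * Q.D2) *ᵥ (sys.C *ᵥ x i (j - 1)))
        + Q.faultInput k (f k) i j := by
  have hP (v) (hv : v ∈ sys.faultSpace k.rev) : Q.P *ᵥ v = 0 := by
    have := hk hv
    rwa [← Q.ker_P] at this
  have h1 : Q.P *ᵥ sys.L1 k.rev = 0 :=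
    hP _ (Submodule.mem_sup_left (Submodule.mem_span_singleton_self _))
  have h2 : Q.P *ᵥ sys.L2 k.rev = 0 :=
    hP _ (Submodule.mem_sup_right (Submodule.mem_span_singleton_self _))
  have hsum (c : Fin 2 → ℝ) (L : Fin 2 → Fin n → ℝ) (hL : Q.P *ᵥ L k.rev = 0) :
      Q.P *ᵥ (∑ l, c l • L l) = c k • (Q.P *ᵥ L k) := by
    rw [Fin.sum_univ_two, Matrix.mulVec_add, Matrix.mulVec_smul, Matrix.mulVec_smul]
    fin_cases k
    · have : Q.P *ᵥ L 1 = 0 := hL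
      simp [this]
    · have : Q.P *ᵥ L 0 = 0 := hL
      simp [this]
  have hx' := hx (i - 1) (j - 1) (by omega)
  rw [sub_add_cancel, sub_add_cancel] at hx'
  have hA1 (v) : Q.Ap1 *ᵥ (Q.P *ᵥ v) = Q.P *ᵥ (sys.A1 *ᵥ v) + (Q.P * Q.D1) *ᵥ (sys.C *ᵥ v) := by
    rw [Matrix.mulVec_mulVec, Q.Ap1_mul]
    simp only [Matrix.mul_add, Matrix.add_mulVec, Matrix.mulVec_mulVec, Matrix.mul_assoc]
  have hA2 (v) : Q.Ap2 *ᵥ (Q.P *ᵥ v) = Q.P *ᵥ (sys.A2 *ᵥ v) + (Q.P * Q.D2) *ᵥ (sys.C *ᵥ v) := by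
    rw [Matrix.mulVec_mulVec, Q.Ap2_mul]
    simp only [Matrix.mul_add, Matrix.add_mulVec, Matrix.mulVec_mulVec, Matrix.mul_assoc]
  rw [delayOp_pencil, hx']
  simp only [Matrix.mulVec_add, hsum _ _ h1, hsum _ _ h2, faultInput, hA1, hA2,
    ← Matrix.mulVec_mulVec]
  abel

open MvPolynomial in
/-- The filter built from a Bézout identity: after the transient its error is the contribution of
the `k`-th fault, filtered by the first Bézout factor. -/
theorem exists_observer_estimate_eq (Q : sys.Subsystem S)
    {U : Matrix (Fin Q.d) (Fin Q.d) (MvPolynomial (Fin 2) ℝ)}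
    {V : Matrix (Fin Q.d) (Fin Q.s) (MvPolynomial (Fin 2) ℝ)}
    (hUV : U * Matrix.pencil Q.Ap1 Q.Ap2 + V * Q.M.constPoly = 1)
    {k : Fin 2} (hk : sys.faultSpace k.rev ≤ S) :
    ∃ (O : Observer m q Q.d) (N₀ : ℕ), ∀ u f x z, sys.IsTrajectory u f x →
      O.IsTrajectory u (fun a b => sys.C *ᵥ x a b) z → ∀ i j : ℤ, (N₀ : ℤ) < i + j →
        O.estimate (fun a b => sys.C *ᵥ x a b) z i j =
          Q.P *ᵥ x i j - delayOp U (Q.faultInput k (f k)) i j := by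
  let Ru : Matrix (Fin Q.d) (Fin m) (MvPolynomial (Fin 2) ℝ) :=
    (X 0 : MvPolynomial (Fin 2) ℝ) • (Q.P * sys.B1).constPoly
      + (X 1 : MvPolynomial (Fin 2) ℝ) • (Q.P * sys.B2).constPoly
  let Ry : Matrix (Fin Q.d) (Fin q) (MvPolynomial (Fin 2) ℝ) :=
    (X 0 : MvPolynomial (Fin 2) ℝ) • (Q.P * Q.D1).constPoly
      + (X 1 : MvPolynomial (Fin 2) ℝ) • (Q.P * Q.D2).constPoly
  obtain ⟨O, N, hO⟩ := Observer.exists_estimate_eq (U * Ru) (V * Q.H.constPoly - U * Ry)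
    (fun a b => by simp [Matrix.mul_apply, Ru])
  obtain ⟨N', hN'⟩ := exists_delayOp_congr U
  refine ⟨O, N + N' + 1, fun u f x z hx hz i j hij => ?_⟩
  push_cast at hij
  rw [hO _ _ _ hz i j (by omega)]
  have hM : delayOp (Q.M.constPoly) (fun i j => Q.P *ᵥ x i j)
      = delayOp (Q.H.constPoly) (fun i j => sys.C *ᵥ x i j) := by
    funext i j
    rw [delayOp_C, delayOp_C, Matrix.mulVec_mulVec, Matrix.mulVec_mulVec, Q.M_mul]
  have hw := congrFun (congrFun (delayOp_one (fun i j => Q.P *ᵥ x i j)) i) j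
  have hW : delayOp U (delayOp (Matrix.pencil Q.Ap1 Q.Ap2) fun i j => Q.P *ᵥ x i j) i j
      = delayOp U (delayOp Ru u) i j - delayOp U (delayOp Ry fun i j => sys.C *ᵥ x i j) i j
        + delayOp U (Q.faultInput k (f k)) i j := by
    rw [hN' _ ((delayOp Ru u + Q.faultInput k (f k)) +
      (delayOp (-Ry) fun i j => sys.C *ᵥ x i j)) i j fun a b hab _ => ?_]
    · have hneg : U * -Ry = 0 - U * Ry := by rw [Matrix.mul_neg, zero_sub]
      have h0 : delayOp (0 : Matrix (Fin Q.d) (Fin q) (MvPolynomial (Fin 2) ℝ))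
          (fun i j => sys.C *ᵥ x i j) = 0 := by funext i j a; simp [delayOp]
      rw [delayOp_signal_add, delayOp_signal_add, ← delayOp_mul U (-Ry), hneg, delayOp_sub, h0,
        delayOp_mul]
      simp only [Pi.add_apply, Pi.sub_apply, Pi.zero_apply]
      abel
    · have hneg : delayOp (-Ry) (fun i j => sys.C *ᵥ x i j)
          = -delayOp Ry (fun i j => sys.C *ᵥ x i j) := by funext i j a; simp [delayOp]
      rw [Q.pencil_mulVec_eq hk hx (by omega), hneg]
      simp only [Pi.add_apply, Pi.neg_apply, Ru, Ry, delayOp_add, delayOp_X_zero, delayOp_X_one]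
      abel
  rw [← hUV, delayOp_add, delayOp_mul, delayOp_mul V, hM, Pi.add_apply, Pi.add_apply, hW] at hw
  rw [← hw, delayOp_sub, delayOp_mul, delayOp_mul, delayOp_mul, Pi.sub_apply, Pi.sub_apply]
  abel

theorem residual_eq (Q : sys.Subsystem S) (O : Observer m q Q.d) (x z) (i j : ℤ)
    (e : Fin Q.d → ℝ)
    (h : O.estimate (fun a b => sys.C *ᵥ x a b) z i j = Q.P *ᵥ x i j - e) :
    Q.residual O x z i j = -(Q.M *ᵥ e) := by
  rw [residual, h, Matrix.mulVec_sub, Matrix.mulVec_mulVec, Matrix.mulVec_mulVec, Q.M_mul]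
  abel

open MvPolynomial in
/-- A visible fault that sets in late has a nonzero effect, after it has set in, through the first
factor of a Bézout identity with strictly causal second factor. -/
theorem Visible.exists_delayOp_ne_zero {Q : sys.Subsystem S} {k : Fin 2} {g : ℤ → ℤ → ℝ}
    (hg : Q.Visible k g)
    {U : Matrix (Fin Q.d) (Fin Q.d) (MvPolynomial (Fin 2) ℝ)}
    {V : Matrix (Fin Q.d) (Fin Q.s) (MvPolynomial (Fin 2) ℝ)}
    (hUV : U * Matrix.pencil Q.Ap1 Q.Ap2 + V * Q.M.constPoly = 1)
    (hV : ∀ a b, constantCoeff (V a b) = 0) {N N' : ℕ}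
    (hU : ∀ (v w : ℤ → ℤ → Fin Q.d → ℝ) (i j : ℤ),
      (∀ a b : ℤ, i + j - N' ≤ a + b → a + b ≤ i + j → v a b = w a b) →
        delayOp U v i j = delayOp U w i j)
    (hN : N' ≤ N) (hg0 : ∀ i j : ℤ, 0 ≤ i + j → i + j ≤ (N : ℤ) → g i j = 0) :
    ∃ i j : ℤ, (N : ℤ) < i + j ∧ Q.M *ᵥ delayOp U (Q.faultInput k g) i j ≠ 0 := by
  obtain ⟨w, hw0, hw, i₀, j₀, hij₀, hne⟩ := hg
  by_contra! hcon
  let w' : ℤ → ℤ → Fin Q.d → ℝ := fun i j => if 0 ≤ i + j then w i j else 0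
  let ℓ : ℤ → ℤ → Fin Q.d → ℝ := fun i j => if 1 ≤ i + j then Q.faultInput k g i j else 0
  have hℓ : delayOp (Matrix.pencil Q.Ap1 Q.Ap2) w' = ℓ := by
    funext i j
    rw [delayOp_pencil]
    by_cases h1 : 1 ≤ i + j
    · have := hw (i - 1) (j - 1) (by omega)
      rw [sub_add_cancel, sub_add_cancel] at this
      simp only [w', ℓ, if_pos h1, if_pos (show 0 ≤ i + j by omega),
        if_pos (show 0 ≤ i - 1 + j by omega), if_pos (show 0 ≤ i + (j - 1) by omega), this,
        faultInput]
      abel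
    · have hwij : w' i j = 0 := by
        simp only [w']
        split_ifs with h0
        · exact hw0 i j (by omega)
        · rfl
      rw [hwij]
      simp only [w', ℓ, if_neg h1, if_neg (show ¬ 0 ≤ i - 1 + j by omega),
        if_neg (show ¬ 0 ≤ i + (j - 1) by omega), Matrix.mulVec_zero, sub_zero]
  have hzero : delayOp (Q.M.constPoly) (delayOp U ℓ) = 0 := by
    funext i j
    rw [delayOp_C, Pi.zero_apply, Pi.zero_apply]
    by_cases hij : (N : ℤ) < i + j
    · rw [hU ℓ (Q.faultInput k g) i j fun a b hab _ => if_pos (by omega)]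
      exact hcon i j hij
    · rw [delayOp_eq_zero_of_past, Matrix.mulVec_zero]
      intro a b hab
      simp only [ℓ]
      split_ifs with h1
      · rw [faultInput, hg0 _ _ (by omega) (by omega), hg0 _ _ (by omega) (by omega)]
        simp
      · rfl
  have hfix : delayOp (Q.M.constPoly * V) (delayOp (Q.M.constPoly) w') = delayOp (Q.M.constPoly) w' := by
    have h := delayOp_one w'
    rw [← hUV, delayOp_add, delayOp_mul, delayOp_mul V, hℓ] at h
    conv_rhs => rw [← h]
    rw [delayOp_signal_add, hzero, zero_add, delayOp_mul]
  have hs := eq_zero_of_delayOp_eq_self (Q.M.constPoly * V)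
    (fun a b => by simp [Matrix.mul_apply, hV]) _ (fun i j hij => by
      rw [delayOp_C]
      simp [w', not_le.2 hij]) hfix
  have := congrFun (congrFun hs i₀) j₀
  rw [delayOp_C] at this
  simp only [w', if_pos hij₀] at this
  exact hne this

end Subsystem

/-- The signal `s` on the half plane `i + j ≥ 0`, delayed by `K` steps and preceded by zero. -/
def delayedStart {E : Type*} [Zero E] (K : ℕ) (s : ℤ → ℤ → E) (i j : ℤ) : E :=
  if (K : ℤ) ≤ i + j then s (i - K) j else 0

theorem delayedStart_of_le {E : Type*} [Zero E] {K : ℕ} (s : ℤ → ℤ → E) {i j : ℤ}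
    (h : (K : ℤ) ≤ i + j) : delayedStart K s i j = s (i - K) j := if_pos h

theorem delayedStart_of_lt {E : Type*} [Zero E] {K : ℕ} (s : ℤ → ℤ → E) {i j : ℤ}
    (h : i + j < (K : ℤ)) : delayedStart K s i j = 0 := if_neg (not_le.2 h)

theorem delayedStart_eq_zero {E : Type*} [Zero E] {K : ℕ} {s : ℤ → ℤ → E}
    (hs : ∀ i j : ℤ, i + j = 0 → s i j = 0) {i j : ℤ} (h : i + j ≤ (K : ℤ)) :
    delayedStart K s i j = 0 := by
  rcases h.lt_or_eq with h | h
  · exact delayedStart_of_lt s h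
  · rw [delayedStart_of_le s h.ge]
    exact hs _ _ (by omega)

theorem IsTrajectory.delayedStart {u f x} (hx : sys.IsTrajectory u f x)
    (h0 : ∀ i j : ℤ, i + j = 0 → x i j = 0) (K : ℕ) :
    sys.IsTrajectory (delayedStart K u) (fun l => FMII.delayedStart K (f l))
      (FMII.delayedStart K x) := by
  intro i j _
  by_cases h : (K : ℤ) ≤ i + j + 1
  · have := hx (i - K) j (by omega)
    simp only [delayedStart_of_le _ (show (K : ℤ) ≤ i + 1 + (j + 1) by omega),
      delayedStart_of_le _ (show (K : ℤ) ≤ i + (j + 1) by omega),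
      delayedStart_of_le _ (show (K : ℤ) ≤ i + 1 + j by omega), add_sub_right_comm, this]
  · rw [delayedStart_eq_zero h0 (show i + 1 + (j + 1) ≤ (K : ℤ) by omega)]
    simp only [delayedStart_of_lt _ (show i + (j + 1) < (K : ℤ) by omega),
      delayedStart_of_lt _ (show i + 1 + j < (K : ℤ) by omega), Matrix.mulVec_zero, zero_smul,
      Finset.sum_const_zero, add_zero]

theorem Observer.IsTrajectory.delayedStart {d : ℕ} {O : Observer m q d} {u y z}
    (hz : O.IsTrajectory u y z) (h0 : ∀ i j : ℤ, i + j = 0 → z i j = 0) (K : ℕ) :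
    O.IsTrajectory (delayedStart K u) (FMII.delayedStart K y) (FMII.delayedStart K z) := by
  intro i j _
  by_cases h : (K : ℤ) ≤ i + j + 1
  · have := hz (i - K) j (by omega)
    simp only [delayedStart_of_le _ (show (K : ℤ) ≤ i + 1 + (j + 1) by omega),
      delayedStart_of_le _ (show (K : ℤ) ≤ i + (j + 1) by omega),
      delayedStart_of_le _ (show (K : ℤ) ≤ i + 1 + j by omega), add_sub_right_comm, this]
  · rw [delayedStart_eq_zero h0 (show i + 1 + (j + 1) ≤ (K : ℤ) by omega)]
    simp only [delayedStart_of_lt _ (show i + (j + 1) < (K : ℤ) by omega),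
      delayedStart_of_lt _ (show i + 1 + j < (K : ℤ) by omega), Matrix.mulVec_zero, add_zero]

theorem mulVec_delayedStart {p : ℕ} (A : Matrix (Fin p) (Fin n) ℝ) (K : ℕ)
    (x : ℤ → ℤ → Fin n → ℝ) :
    (fun a b => A *ᵥ delayedStart K x a b) = delayedStart K fun a b => A *ᵥ x a b := by
  funext i j
  simp only [delayedStart]
  split_ifs <;> simp

namespace Subsystem

theorem Visible.delayedStart {Q : sys.Subsystem S} {k : Fin 2} {g : ℤ → ℤ → ℝ}
    (hg : Q.Visible k g) (K : ℕ) : Q.Visible k (delayedStart K g) := by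
  obtain ⟨w, hw0, hw, i₀, j₀, hij₀, hne⟩ := hg
  refine ⟨FMII.delayedStart K w, fun i j h => delayedStart_eq_zero hw0 (by omega),
    fun i j _ => ?_, i₀ + K, j₀, by omega, ?_⟩
  · by_cases h : (K : ℤ) ≤ i + j + 1
    · have := hw (i - K) j (by omega)
      simp only [delayedStart_of_le _ (show (K : ℤ) ≤ i + 1 + (j + 1) by omega),
        delayedStart_of_le _ (show (K : ℤ) ≤ i + (j + 1) by omega),
        delayedStart_of_le _ (show (K : ℤ) ≤ i + 1 + j by omega), add_sub_right_comm, this]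
    · rw [delayedStart_eq_zero hw0 (show i + 1 + (j + 1) ≤ (K : ℤ) by omega)]
      simp only [delayedStart_of_lt _ (show i + (j + 1) < (K : ℤ) by omega),
        delayedStart_of_lt _ (show i + 1 + j < (K : ℤ) by omega), Matrix.mulVec_zero, zero_smul,
        add_zero]
  · rwa [delayedStart_of_le _ (by omega), add_sub_cancel_right]

/-- A right zero prime subsystem that factors out the other fault has an ordinary deadbeat detector. -/
theorem exists_isDeadbeatDetector (Q : sys.Subsystem S) (hQ : Q.RightZeroPrime) {k : Fin 2}
    (hk : sys.faultSpace k.rev ≤ S) :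
    ∃ (O : Observer m q Q.d) (N : ℕ), Q.IsDeadbeatDetector k O N := by
  obtain ⟨U, V, hUV, hV⟩ := Matrix.exists_bezout_of_rank_eq Q.Ap1 Q.Ap2 Q.M hQ
  obtain ⟨O, N₀, hO⟩ := Q.exists_observer_estimate_eq hUV hk
  obtain ⟨N', hN'⟩ := exists_delayOp_congr U
  have hzero (g : ℤ → ℤ → ℝ) (hg : ∀ i j : ℤ, 0 ≤ i + j → g i j = 0) (i j : ℤ)
      (hij : ((N₀ + N' : ℕ) : ℤ) < i + j) : delayOp U (Q.faultInput k g) i j = 0 := by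
    push_cast at hij
    rw [hN' _ 0 i j fun a b hab _ => ?_, delayOp_eq_zero_of_past U 0 i j fun _ _ _ => rfl]
    rw [faultInput, hg _ _ (by omega), hg _ _ (by omega)]
    simp
  have late : ∀ u f x z, sys.IsTrajectory u f x →
      O.IsTrajectory u (fun a b => sys.C *ᵥ x a b) z →
      (∀ i j : ℤ, 0 ≤ i + j → i + j ≤ ((N₀ + N' : ℕ) : ℤ) → f k i j = 0) →
      Q.Visible k (f k) →
        ∃ i j : ℤ, ((N₀ + N' : ℕ) : ℤ) < i + j ∧ Q.residual O x z i j ≠ 0 := by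
    intro u f x z hx hz hf hvis
    obtain ⟨i, j, hij, hne⟩ :=
      hvis.exists_delayOp_ne_zero hUV hV hN' (Nat.le_add_left N' N₀) hf
    refine ⟨i, j, hij, ?_⟩
    rw [Q.residual_eq O x z i j _ (hO u f x z hx hz i j (by push_cast at hij; omega))]
    exact neg_ne_zero.2 hne
  refine ⟨O, N₀ + N', ⟨fun u f x z hx hz hf i j hij => ?_, fun u f x z hx hz hf i j hij => ?_,
    fun u f x z hx hz h0 hvis => ?_, late⟩⟩
  · rw [hO u f x z hx hz i j (by push_cast at hij; omega), hzero _ hf i j hij, sub_zero]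
  · rw [Q.residual_eq O x z i j _ (hO u f x z hx hz i j (by push_cast at hij; omega)),
      hzero _ hf i j hij, Matrix.mulVec_zero, neg_zero]
  · let K := N₀ + N' + 1
    obtain ⟨i, j, hij, hne⟩ := late (FMII.delayedStart K u) (fun l => FMII.delayedStart K (f l))
      (FMII.delayedStart K x) (FMII.delayedStart K z)
      (hx.delayedStart (fun i j h => (h0 i j h).1) K)
      (by
        rw [mulVec_delayedStart]
        exact hz.delayedStart (fun i j h => (h0 i j h).2) K)
      (fun i j _ h => delayedStart_of_lt _ (by simp only [K]; push_cast at h ⊢; omega))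
      (hvis.delayedStart K)
    have hKij : (K : ℤ) ≤ i + j := by simp only [K]; push_cast at hij ⊢; omega
    refine ⟨i - K, j, by omega, ?_⟩
    simpa only [residual, Observer.estimate, delayedStart_of_le _ hKij] using hne

/-- A quotient by the smallest unobservability subspace that satisfies the output condition and is
right zero prime solves detection and isolation of the `k`-th fault. -/
theorem deadbeatSolves (Q : sys.Subsystem S) {k : Fin 2}
    (hS : sys.IsSmallestUnobservability k S) (hQ : Q.OutputCondition)
    (hk : ¬ sys.faultSpace k ≤ S) (hrank : Q.RightZeroPrime) : Q.DeadbeatSolves k :=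
  ⟨⟨Q.eq_unobservable hS.1.1 hQ, hS.1.2, hk⟩, Q.exists_isDeadbeatDetector hrank hS.1.2⟩

end Subsystem

end FMII

theorem mainTheorem6 {n m q : ℕ} (sys : FMII n m q) :
    (∀ (k : Fin 2) (S : Submodule ℝ (Fin n → ℝ)) (Q : sys.Subsystem S),
      sys.IsSmallestUnobservability k S → Q.OutputCondition →
      ¬ sys.faultSpace k ≤ S → Q.RightZeroPrime → Q.DeadbeatSolves k) ∧
    ((∀ k : Fin 2, ∃ (S : Submodule ℝ (Fin n → ℝ)) (Q : sys.Subsystem S),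
      sys.IsSmallestUnobservability k S ∧ Q.OutputCondition ∧
      ¬ sys.faultSpace k ≤ S ∧ Q.RightZeroPrime) → sys.FDISolvableByDeadbeat) := by
  refine ⟨fun k S Q hS hQ hk hrank => Q.deadbeatSolves hS hQ hk hrank, fun h k => ?_⟩
  obtain ⟨S, Q, hS, hQ, hk, hrank⟩ := h k
  exact ⟨S, Q, Q.deadbeatSolves hS hQ hk hrank⟩
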